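/- Let $\mathbb{G}$ be a connected graph with vertex set $\mathbb{V}$, graph distance $d$ and a fixed reference vertex $o\in\mathbb V$; write $|u|=d(o,u)$, $S_L(u)=\{v\in\mathbb V: d(u,v)=L\}$ and let $\{\delta_v\}_{v\in\mathbb{V}}$ be the canonical basis of $\ell^2(\mathbb V)$. Assume that there are $\beta\in[0,1)$ and a constant $K$ such that $$\sup_{u\in\mathbb V}\# S_L(u)\le K\,e^{L^\beta}\qquad\text{for all } L\in\mathbb{N}_0 .$$ Let $H$ be a self-adjoint (possibly unbounded) operator on $\ell^2(\mathbb V)$ and let $I\subset\mathbb R$ be an interval in which $H$ has pure point spectrum (the range of $\chi_I(H)$ is the closed span of the eigenvectors of $H$ with eigenvalue in $I$). Let $\mathcal C^\infty_{c,+}(I)$ be the set of nonnegative smooth functions on $\mathbb{R}$ with compact support contained in $I$, let $\chi_x$ be the orthogonal projection onto $\mathbb C\delta_x$, $P_E=\chi_{\{E\}}(H)$, $\|\cdot\|_2$ the Hilbert–Schmidt norm, and $$M_u(\sigma,\zeta,\mathcal X,t)=\sum_{v\in\mathbb V}e^{\sigma d(u,v)^\zeta}\,|\langle\delta_v,e^{-itH}\mathcal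 X(H)\delta_u\rangle|^2 .$$ Then for every $\zeta\in(\beta,1]$ the following properties are equivalent. (i) There is $\sigma>0$ such that for all $\epsilon>0$ and $\mathcal X\in\mathcal C^\infty_{c,+}(I)$ there is $C<\infty$ with $\displaystyle\sup_{T>0}\frac1T\int_0^TM_u(\sigma,\zeta,\mathcal X,t)\,dt\le C e^{\epsilon|u|^\zeta}$ for all $u\in\mathbb V$. (ii) There is $\sigma>0$ such that for all $\epsilon>0$ and $\mathcal X\in\mathcal C^\infty_{c,+}(I)$ there is $C<\infty$ with $\displaystyle\sup_{T>0}\frac1T\int_0^\infty e^{-t/T}M_u(\sigma,\zeta,\mathcal X,t)\,dt\le C e^{\epsilon|u|^\zeta}$ for all $u\in\mathbb V$. (iii) (dynamical localization) There is $\sigma>0$ such that for all $\epsilon>0$ and $\mathcal X\in\mathcal C^\infty_{c,+}(I)$ there is $C<\infty$ with $\displaystyle\sup_{t\in\mathbb R}M_u(\sigma,\zeta,\mathcal X,t)\le C e^{\epsilon|u|^\zeta}$ for all $u\in\mathbb V$. (iv) (SUDL) There is $\sigma>0$ such that for all $\epsilon>0$ and $\mathcal X\in\mathcal C^\infty_{c,+}(I)$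 there is $C<\infty$ with $\displaystyle\sup_{t\in\mathbb R}\|\chi_xe^{-itH}\mathcal X(H)\chi_u\|_2\le C e^{\epsilon|u|^\zeta}e^{-\sigma d(x,u)^\zeta}$ for all $x,u\in\mathbb V$. (v) (SULP) There is $\sigma>0$ such that for all $\epsilon>0$ and $\mathcal X\in\mathcal C^\infty_{c,+}(I)$ there is $C<\infty$ with $\displaystyle\sup_{E\in\mathbb R}\mathcal X(E)\|\chi_xP_E\chi_u\|_2\le C e^{\epsilon|u|^\zeta}e^{-\sigma d(x,u)^\zeta}$ for all $x,u\in\mathbb V$. -/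

import Mathlib

open scoped ContDiff ENNReal

noncomputable section

namespace DynLoc

/-! ### Self-adjoint, possibly unbounded, operators on a Hilbert space -/

section Hilbert

variable {F : Type*} [NormedAddCommGroup F] [InnerProductSpace ℂ F]

/-- `R` is the bounded everywhere defined inverse of `H - z`. -/
def IsResolventAt (H : F →ₗ.[ℂ] F) (z : ℂ) (R : F →L[ℂ] F) : Prop :=
  (∀ ψ : F, ∃ h : R ψ ∈ H.domain, H ⟨R ψ, h⟩ - z • R ψ = ψ) ∧
    ∀ φ : H.domain, R (H φ - z • (φ : F)) = φ

open Classical in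
/-- The resolvent `(H - z)⁻¹`. It is only used at `z = -i` and for self-adjoint `H`, where it exists
by `exists_isResolventAt` below; where there is no bounded inverse the value is `0`. -/
def resolventAt (H : F →ₗ.[ℂ] F) (z : ℂ) : F →L[ℂ] F :=
  if h : ∃ R : F →L[ℂ] F, IsResolventAt H z R then h.choose else 0

/-- The eigenspace `ker (H - E)` for a real number `E` (it is `{0}` unless `E` is an eigenvalue). -/
def eigenspace (H : F →ₗ.[ℂ] F) (E : ℝ) : Submodule ℂ F :=
  (LinearMap.ker (H.toFun - (E : ℂ) • H.domain.subtype)).map H.domain.subtype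

theorem mem_eigenspace {H : F →ₗ.[ℂ] F} {E : ℝ} {ψ : F} :
    ψ ∈ eigenspace H E ↔ ∃ h : ψ ∈ H.domain, H ⟨ψ, h⟩ = (E : ℂ) • ψ := by
  simp only [eigenspace, Submodule.mem_map, LinearMap.mem_ker, LinearMap.sub_apply,
    LinearMap.smul_apply, Submodule.subtype_apply, sub_eq_zero]
  constructor
  · rintro ⟨φ, h, rfl⟩
    exact ⟨φ.2, h⟩
  · rintro ⟨h, h'⟩
    exact ⟨⟨ψ, h⟩, h', rfl⟩

variable [CompleteSpace F]

/-- `H + i` has a bounded inverse when `H` is self-adjoint. -/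
theorem exists_isResolventAt {H : F →ₗ.[ℂ] F} (hH : IsSelfAdjoint H) :
    ∃ R : F →L[ℂ] F, IsResolventAt H (-Complex.I) R := by
  have hd := hH.dense_domain
  have hsymm : ∀ φ ψ : H.domain, inner ℂ (H φ) (ψ : F) = inner ℂ (φ : F) (H ψ) := by
    have h := LinearPMap.adjoint_isFormalAdjoint hd
    rw [LinearPMap.isSelfAdjoint_def.mp hH] at h
    exact fun φ ψ => h φ ψ
  let T : H.domain →ₗ[ℂ] F := H.toFun + Complex.I • H.domain.subtype
  have hT : ∀ φ, T φ = H φ + Complex.I • (φ : F) := fun φ => rfl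
  have hnorm : ∀ φ : H.domain, ‖T φ‖ ^ 2 = ‖H φ‖ ^ 2 + ‖(φ : F)‖ ^ 2 := by
    intro φ
    have h1 : (RCLike.re (inner ℂ (H φ) (Complex.I • (φ : F))) : ℝ) = 0 := by
      have h2 : (starRingEnd ℂ) (inner ℂ (H φ) (φ : F)) = inner ℂ (H φ) (φ : F) := by
        rw [inner_conj_symm, hsymm]
      have h3 : (inner ℂ (H φ) (φ : F) : ℂ).im = 0 := Complex.conj_eq_iff_im.mp h2
      rw [inner_smul_right]
      simp [h3]
    rw [hT, norm_add_sq (𝕜 := ℂ), h1, norm_smul]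
    simp
  have hle : ∀ φ : H.domain, ‖φ‖ ≤ ‖T φ‖ := by
    intro φ
    have := hnorm φ
    refine le_of_sq_le_sq ?_ (norm_nonneg _)
    rw [this]
    have : ‖(φ : F)‖ = ‖φ‖ := rfl
    rw [this]
    nlinarith [sq_nonneg ‖H φ‖]
  have hclosed : IsClosed (LinearMap.range T : Set F) := by
    refine isClosed_of_closure_subset fun y hy => ?_
    obtain ⟨u, hu, hlim⟩ := mem_closure_iff_seq_limit.mp hy
    choose φ hφ using hu
    have hc : CauchySeq fun n => (φ n : F) := by
      have hcu := hlim.cauchySeq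
      rw [Metric.cauchySeq_iff'] at hcu ⊢
      intro e he
      obtain ⟨N, hN⟩ := hcu e he
      refine ⟨N, fun n hn => lt_of_le_of_lt ?_ (hN n hn)⟩
      rw [dist_eq_norm, dist_eq_norm, ← hφ, ← hφ, ← map_sub]
      exact hle (φ n - φ N)
    obtain ⟨x, hx⟩ := cauchySeq_tendsto_of_complete hc
    have hHx : Filter.Tendsto (fun n => H (φ n)) Filter.atTop (nhds (y - Complex.I • x)) := by
      have h1 := hlim.sub (hx.const_smul Complex.I)
      refine h1.congr fun n => ?_
      rw [← hφ, hT, add_sub_cancel_right]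
    have hmem : (x, y - Complex.I • x) ∈ (H.graph : Set (F × F)) := by
      refine hH.isClosed.mem_of_tendsto (hx.prodMk_nhds hHx) (Filter.Eventually.of_forall fun n => ?_)
      exact H.mem_graph (φ n)
    obtain ⟨z, hz1, hz2⟩ := LinearPMap.mem_graph_iff H |>.mp hmem
    refine ⟨z, ?_⟩
    rw [hT, hz2, hz1]
    simp
  have hperp : (LinearMap.range T)ᗮ = ⊥ := by
    rw [Submodule.eq_bot_iff]
    intro ψ hψ
    rw [Submodule.mem_orthogonal'] at hψ
    have h1 : ∀ φ : H.domain, inner ℂ (Complex.I • ψ) (φ : F) = inner ℂ ψ (H φ) := by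
      intro φ
      have h2 := hψ (T φ) ⟨φ, rfl⟩
      rw [hT, inner_add_right, inner_smul_right] at h2
      rw [inner_smul_left, Complex.conj_I]
      linear_combination -h2
    have hmem : ψ ∈ H.adjoint.domain := H.mem_adjoint_domain_of_exists ψ ⟨_, h1⟩
    have hval := LinearPMap.adjoint_apply_eq hd ⟨ψ, hmem⟩ h1
    have hgr : (ψ, Complex.I • ψ) ∈ H.graph := by
      rw [← LinearPMap.isSelfAdjoint_def.mp hH]
      exact (LinearPMap.mem_graph_iff _).mpr ⟨⟨ψ, hmem⟩, rfl, hval⟩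
    obtain ⟨z, hz1, hz2⟩ := LinearPMap.mem_graph_iff H |>.mp hgr
    simp only at hz1 hz2
    have h3 := hsymm z z
    rw [hz2, hz1, inner_smul_left, inner_smul_right, Complex.conj_I] at h3
    have h4 : (inner ℂ ψ ψ : ℂ) = 0 := by
      have h5 : (2 * Complex.I) * inner ℂ ψ ψ = 0 := by linear_combination -h3
      simpa using h5
    exact inner_self_eq_zero.mp h4
  have hsurj : Function.Surjective T := by
    have : CompleteSpace (LinearMap.range T) := hclosed.completeSpace_coe
    exact LinearMap.range_eq_top.mp (Submodule.orthogonal_eq_bot_iff.mp hperp)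
  have hinj : Function.Injective T := by
    refine (injective_iff_map_eq_zero T).mpr fun φ h => ?_
    have := hle φ
    rw [h, norm_zero] at this
    exact norm_le_zero_iff.mp this
  let e := LinearEquiv.ofBijective T ⟨hinj, hsurj⟩
  have he : ∀ ψ, T (e.symm ψ) = ψ := fun ψ => e.apply_symm_apply ψ
  let R : F →L[ℂ] F := (H.domain.subtype ∘ₗ e.symm.toLinearMap).mkContinuous 1 (by
    intro ψ
    rw [one_mul]
    calc _ ≤ ‖T (e.symm ψ)‖ := hle (e.symm ψ)
      _ = ‖ψ‖ := by rw [he])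
  have hR : ∀ ψ, R ψ = (e.symm ψ : F) := fun ψ => rfl
  refine ⟨R, fun ψ => ⟨(e.symm ψ).2, ?_⟩, fun φ => ?_⟩
  · have := he ψ
    rw [hT] at this
    rw [neg_smul, sub_neg_eq_add]
    exact this
  · rw [neg_smul, sub_neg_eq_add, ← hT, hR]
    exact congrArg Subtype.val (e.symm_apply_apply φ)

/-- The spectral projection `P_E = χ_{E}(H)`: the orthogonal projection onto `ker (H - E)`
(which is already closed when `H` is self-adjoint). -/
def eigenproj (H : F →ₗ.[ℂ] F) (E : ℝ) : F →L[ℂ] F :=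
  (eigenspace H E).topologicalClosure.starProjection

/-- The functional calculus `f(H)` of a self-adjoint operator `H`, for a continuous function `f` on
the line that vanishes at infinity. The operator `R = (H + i)⁻¹` is bounded and normal, the map
`E ↦ (E + i)⁻¹` carries the spectrum of `H` into that of `R`, and `f(H)` is `g(R)` (continuous
functional calculus of `R`) for the function `g` with `g((E + i)⁻¹) = f(E)` and `g(0) = 0`. -/
def funcCalc (H : F →ₗ.[ℂ] F) (f : ℝ → ℂ) : F →L[ℂ] F :=
  cfc (fun z : ℂ => if z = 0 then 0 else f (z⁻¹).re) (resolventAt H (-Complex.I))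

/-- `H` has pure point spectrum in the interval `I`: the spectral subspace of `H` for `I` is spanned
by the eigenvectors with eigenvalue in `I`. The spectral subspace is tested through the operators
`f(H)` with `f` continuous and compactly supported in `I`; their ranges span a dense subspace of the
spectral subspace for the interior of `I`, and an end point of `I` can only contribute
eigenvectors. -/
def HasPurePointSpectrumIn (H : F →ₗ.[ℂ] F) (I : Set ℝ) : Prop :=
  ∀ f : ℝ → ℂ, Continuous f → HasCompactSupport f → tsupport f ⊆ I →
    ∀ ψ : F, funcCalc H f ψ ∈ (⨆ E ∈ I, eigenspace H E).topologicalClosure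

/-- The operator `e^{-itH} X(H)`, that is `f(H)` for `f(E) = e^{-itE} X(E)`. -/
def evolution (H : F →ₗ.[ℂ] F) (X : ℝ → ℝ) (t : ℝ) : F →L[ℂ] F :=
  funcCalc H fun E => Complex.exp (-(Complex.I * t * E)) * (X E : ℂ)

end Hilbert

/-- Smooth nonnegative functions on the line with compact support contained in `I`. -/
structure IsEnergyCutoff (I : Set ℝ) (X : ℝ → ℝ) : Prop where
  smooth : ContDiff ℝ ∞ X
  compact : HasCompactSupport X
  support : tsupport X ⊆ I
  nonneg : ∀ E, 0 ≤ X E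

/-! ### Graphs -/

section Graph

variable {V : Type*}

/-- The Hilbert space `ℓ²(V)` of a vertex set. -/
abbrev L2 (V : Type*) : Type _ := lp (fun _ : V => ℂ) 2

open Classical in
/-- The canonical basis vector at the vertex `v`. -/
def delta (v : V) : L2 V := lp.single 2 v (1 : ℂ)

/-- The projection `χ_v` onto the site `v` (multiplication by the indicator function of `{v}`). -/
def chi (v : V) : L2 V →L[ℂ] L2 V := InnerProductSpace.rankOne ℂ (delta v) (delta v)

/-- The Hilbert-Schmidt norm `‖A‖₂ = (∑ ‖A δ_v‖²)^{1/2}`. -/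
def hsNorm (A : L2 V →L[ℂ] L2 V) : ℝ≥0∞ := (∑' v : V, ‖A (delta v)‖ₑ ^ 2) ^ (1 / 2 : ℝ)

/-- The sphere of radius `L` around `u` for the graph distance. -/
def sphere (G : SimpleGraph V) (u : V) (L : ℕ) : Set V := {v | G.dist u v = L}

/-- The number of vertices of a sphere. -/
def sphereCard (G : SimpleGraph V) (u : V) (L : ℕ) : ℝ≥0∞ := ((sphere G u L).encard : ℝ≥0∞)

/-- The subexponential moment at time `t`,
`M_u(σ, ζ, X, t) = ∑_v e^{σ d(u,v)^ζ} |⟨δ_v, e^{-itH} X(H) δ_u⟩|²`. -/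
def moment (G : SimpleGraph V) (H : L2 V →ₗ.[ℂ] L2 V) (u : V) (σ ζ : ℝ) (X : ℝ → ℝ) (t : ℝ) :
    ℝ≥0∞ :=
  ∑' v : V, ENNReal.ofReal (Real.exp (σ * (G.dist u v : ℝ) ^ ζ)) *
    ‖inner ℂ (delta v) (evolution H X t (delta u))‖ₑ ^ 2

/-! The five localization properties in `I`, at a given exponent `ζ`. The vertex `o` is the origin:
`|u| = d(o, u)`. -/

/-- Time averaged dynamical localization, Cesàro means. -/
def AveragedDL (G : SimpleGraph V) (o : V) (H : L2 V →ₗ.[ℂ] L2 V) (I : Set ℝ) (ζ : ℝ) : Prop :=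
  ∃ σ : ℝ, 0 < σ ∧ ∀ ε : ℝ, 0 < ε → ∀ X : ℝ → ℝ, IsEnergyCutoff I X → ∃ C : ℝ, ∀ u : V,
    (⨆ (T : ℝ) (_ : 0 < T),
        ENNReal.ofReal (1 / T) * ∫⁻ t in Set.Ioc 0 T, moment G H u σ ζ X t)
      ≤ ENNReal.ofReal (C * Real.exp (ε * (G.dist o u : ℝ) ^ ζ))

/-- Time averaged dynamical localization, Abel means. -/
def AbelDL (G : SimpleGraph V) (o : V) (H : L2 V →ₗ.[ℂ] L2 V) (I : Set ℝ) (ζ : ℝ) : Prop :=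
  ∃ σ : ℝ, 0 < σ ∧ ∀ ε : ℝ, 0 < ε → ∀ X : ℝ → ℝ, IsEnergyCutoff I X → ∃ C : ℝ, ∀ u : V,
    (⨆ (T : ℝ) (_ : 0 < T), ENNReal.ofReal (1 / T) *
        ∫⁻ t in Set.Ioi 0, ENNReal.ofReal (Real.exp (-t / T)) * moment G H u σ ζ X t)
      ≤ ENNReal.ofReal (C * Real.exp (ε * (G.dist o u : ℝ) ^ ζ))

/-- Dynamical localization. -/
def DL (G : SimpleGraph V) (o : V) (H : L2 V →ₗ.[ℂ] L2 V) (I : Set ℝ) (ζ : ℝ) : Prop :=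
  ∃ σ : ℝ, 0 < σ ∧ ∀ ε : ℝ, 0 < ε → ∀ X : ℝ → ℝ, IsEnergyCutoff I X → ∃ C : ℝ, ∀ u : V,
    (⨆ t : ℝ, moment G H u σ ζ X t) ≤ ENNReal.ofReal (C * Real.exp (ε * (G.dist o u : ℝ) ^ ζ))

/-- Semi-uniform dynamical localization. -/
def SUDL (G : SimpleGraph V) (o : V) (H : L2 V →ₗ.[ℂ] L2 V) (I : Set ℝ) (ζ : ℝ) : Prop :=
  ∃ σ : ℝ, 0 < σ ∧ ∀ ε : ℝ, 0 < ε → ∀ X : ℝ → ℝ, IsEnergyCutoff I X → ∃ C : ℝ, ∀ x u : V,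
    (⨆ t : ℝ, hsNorm (chi x ∘L evolution H X t ∘L chi u))
      ≤ ENNReal.ofReal (C * Real.exp (ε * (G.dist o u : ℝ) ^ ζ) *
          Real.exp (-(σ * (G.dist x u : ℝ) ^ ζ)))

/-- Semi-uniformly localized projections. -/
def SULP (G : SimpleGraph V) (o : V) (H : L2 V →ₗ.[ℂ] L2 V) (I : Set ℝ) (ζ : ℝ) : Prop :=
  ∃ σ : ℝ, 0 < σ ∧ ∀ ε : ℝ, 0 < ε → ∀ X : ℝ → ℝ, IsEnergyCutoff I X → ∃ C : ℝ, ∀ x u : V,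
    (⨆ E : ℝ, ENNReal.ofReal (X E) * hsNorm (chi x ∘L eigenproj H E ∘L chi u))
      ≤ ENNReal.ofReal (C * Real.exp (ε * (G.dist o u : ℝ) ^ ζ) *
          Real.exp (-(σ * (G.dist x u : ℝ) ^ ζ)))

end Graph

end DynLoc

end

open DynLoc

namespace DynLoc

open Filter Topology

/-! ### Functional calculus of a self-adjoint operator and its eigenvector expansion. -/

section Operators

variable {F : Type*} [NormedAddCommGroup F] [InnerProductSpace ℂ F] [CompleteSpace F]

/-! On an interval of pure point spectrum, `⟨δ_x, e^{-itH} X(H) δ_u⟩` is a trigonometric series in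
`t` with absolutely summable coefficients `a_E = X(E) ⟨δ_x, P_E δ_u⟩` (`hasSum_funcCalc`,
`hasSum_inner_evolution`). All five properties are compared through these coefficients, in the cycle
averaged DL ⇒ SULP ⇒ SUDL ⇒ DL ⇒ Abel DL ⇒ averaged DL.

Averaged DL gives SULP by Wiener's argument: the time average of `|∑ a_E e^{-itE}|²` asymptotically
dominates each `|a_E|²` (`norm_sq_coeff_le_of_average_le`).

The substantial step is SULP ⇒ SUDL, where a bound on each `|a_E|` must become a bound on `∑_E
|a_E|`. Fix `u` and let `w_E = X(E)² ‖P_E δ_u‖²`, a sum over sites `y` of `X(E)² |⟨δ_y, P_E δ_u⟩|²`.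
Each term is at most `‖P_E δ_y‖² w_E` by Cauchy-Schwarz, and is small for `y` far from `u` by SULP.
The sites where the decay bound is too small to compete with `w_E` carry at most half of `w_E`; on
the others a power of `w_E` is dominated by a decaying function of `y`. Summing over `E` with
Bessel's inequality `∑_E ‖P_E δ_y‖² ≤ 1` gives `∑_E w_E^s < ∞` for small powers `s`
(`sum_rpow_weight_le`). Finally `|a_E| ≤ |a_E|^{1/2} w_E^{1/4}`: the first factor keeps half the
decay rate, the second is summable in `E`.

The growth condition on spheres enters only through the uniform summability of `e^{-a d(u,v)^ζ}`,
used for SULP ⇒ SUDL and SUDL ⇒ DL. -/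

theorem star_apply_eigenvector {R : F →L[ℂ] F} (hR : IsStarNormal R) {μ : ℂ} {ψ : F}
    (h : R ψ = μ • ψ) : star R ψ = star μ • ψ := by
  have hn : IsStarNormal (R - μ • (1 : F →L[ℂ] F)) := by
    constructor
    rw [star_sub, star_smul, star_one]
    exact (hR.star_comm_self.sub_left ((Commute.one_left _).smul_left _)).sub_right
      (((Commute.one_right _).smul_right _))
  have h0 := (ContinuousLinearMap.IsStarNormal.adjoint_apply_eq_zero_iff hn ψ).mpr (by simp [h])
  rw [← ContinuousLinearMap.star_eq_adjoint, star_sub, star_smul, star_one] at h0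
  simpa [sub_eq_zero] using h0

omit [CompleteSpace F] in
theorem mem_spectrum_of_eigenvector {R : F →L[ℂ] F} {μ : ℂ} {ψ : F} (hψ : ψ ≠ 0)
    (h : R ψ = μ • ψ) : μ ∈ spectrum ℂ R := by
  rw [spectrum.mem_iff]
  intro hu
  obtain ⟨u, hu⟩ := hu
  have h1 : (algebraMap ℂ (F →L[ℂ] F) μ - R) ψ = 0 := by
    simp [Algebra.algebraMap_eq_smul_one, h]
  rw [← hu] at h1
  apply hψ
  calc ψ = ((u⁻¹ : (F →L[ℂ] F)ˣ) * (u : F →L[ℂ] F) : F →L[ℂ] F) ψ := by simp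
    _ = 0 := by rw [mul_apply_eq_comp, h1, map_zero]

/-- The continuous functional calculus of a normal operator acts on an eigenvector by the value of
the function at the eigenvalue. -/
theorem cfc_apply_eigenvector {R : F →L[ℂ] F} (hR : IsStarNormal R) {μ : ℂ} {ψ : F} (hψ : ψ ≠ 0)
    (h : R ψ = μ • ψ) {g : ℂ → ℂ} (hg : ContinuousOn g (spectrum ℂ R)) :
    cfc g R ψ = g μ • ψ := by
  have hμ := mem_spectrum_of_eigenvector hψ h
  have key : ∀ f : C(spectrum ℂ R, ℂ), cfcHom hR f ψ = f ⟨μ, hμ⟩ • ψ := by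
    intro f
    induction f using ContinuousMap.induction_on_of_compact with
    | const r =>
      have : cfcHom hR (ContinuousMap.const (spectrum ℂ R) r) = algebraMap ℂ (F →L[ℂ] F) r :=
        AlgHomClass.commutes (cfcHom hR) r
      rw [this]
      simp [Algebra.algebraMap_eq_smul_one]
    | id => rw [cfcHom_id hR, h]; rfl
    | star_id => rw [map_star, cfcHom_id, star_apply_eigenvector hR h]; rfl
    | add f g hf hg => simp [map_add, hf, hg, add_smul]
    | mul f g hf hg => simp [map_mul, hf, hg, smul_smul, mul_comm]
    | frequently f hf =>
      have hc : IsClosed {f : C(spectrum ℂ R, ℂ) | cfcHom hR f ψ = f ⟨μ, hμ⟩ • ψ} := by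
        refine isClosed_eq ?_ ?_
        · exact (ContinuousLinearMap.apply ℂ F ψ).continuous.comp (cfcHom_continuous hR)
        · fun_prop
      exact hc.closure_subset (mem_closure_iff_frequently.mpr hf)
  rw [cfc_apply g R hR hg, key]
  rfl

variable {H : F →ₗ.[ℂ] F}

theorem resolventAt_spec (hH : IsSelfAdjoint H) :
    IsResolventAt H (-Complex.I) (resolventAt H (-Complex.I)) := by
  rw [resolventAt, dif_pos (exists_isResolventAt hH)]
  exact (exists_isResolventAt hH).choose_spec

theorem inner_apply_comm (hH : IsSelfAdjoint H) (φ ψ : H.domain) :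
    inner ℂ (H φ) (ψ : F) = inner ℂ (φ : F) (H ψ) := by
  have h := LinearPMap.adjoint_isFormalAdjoint hH.dense_domain
  rw [LinearPMap.isSelfAdjoint_def.mp hH] at h
  exact h φ ψ

/-- The resolvent identity `R - R* = -2i R* R`. -/
theorem resolvent_sub_star (hH : IsSelfAdjoint H) {R : F →L[ℂ] F}
    (hR : IsResolventAt H (-Complex.I) R) :
    R - star R = (-(2 * Complex.I)) • (star R * R) := by
  ext ψ
  refine ext_inner_left ℂ fun φ => ?_
  obtain ⟨ha, ha'⟩ := hR.1 ψ
  obtain ⟨hb, hb'⟩ := hR.1 φ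
  have hs := inner_apply_comm hH ⟨R φ, hb⟩ ⟨R ψ, ha⟩
  have h1 : inner ℂ φ (R ψ) = inner ℂ (H ⟨R φ, hb⟩) (R ψ) - Complex.I * inner ℂ (R φ) (R ψ) := by
    conv_lhs => rw [← hb']
    rw [inner_sub_left, inner_smul_left]
    simp
  have h2 : inner ℂ (R φ) ψ = inner ℂ (R φ) (H ⟨R ψ, ha⟩) + Complex.I * inner ℂ (R φ) (R ψ) := by
    conv_lhs => rw [← ha']
    rw [inner_sub_right, inner_smul_right]
    simp
  simp only [sub_apply, smul_apply,
    mul_apply_eq_comp, inner_sub_right, inner_smul_right,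
    ContinuousLinearMap.star_eq_adjoint, ContinuousLinearMap.adjoint_inner_right]
  rw [h1, h2, ← hs]
  ring

/-- The resolvent identity `R - R* = -2i R R*`. -/
theorem resolvent_sub_star' (hH : IsSelfAdjoint H) {R : F →L[ℂ] F}
    (hR : IsResolventAt H (-Complex.I) R) :
    R - star R = (-(2 * Complex.I)) • (R * star R) := by
  ext φ
  -- This says that `R*φ` lies in the domain of `H* = H` with `H R*φ = φ + i R*φ`. Applying `R` to
  -- `(H + i) R*φ = φ + 2i R*φ` then gives the identity.
  have hw : ∀ a : H.domain,
      inner ℂ (φ + Complex.I • star R φ) (a : F) = inner ℂ (star R φ) (H a) := by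
    intro a
    have h1 : inner ℂ (star R φ) (H a - -Complex.I • (a : F)) = inner ℂ φ (a : F) := by
      rw [ContinuousLinearMap.star_eq_adjoint, ContinuousLinearMap.adjoint_inner_left, hR.2 a]
    rw [inner_sub_right, inner_smul_right] at h1
    rw [inner_add_left, inner_smul_left, Complex.conj_I]
    linear_combination -h1
  have hmem : star R φ ∈ H.adjoint.domain := H.mem_adjoint_domain_of_exists _ ⟨_, hw⟩
  have hval := LinearPMap.adjoint_apply_eq hH.dense_domain ⟨_, hmem⟩ hw
  have hgr : (star R φ, φ + Complex.I • star R φ) ∈ H.graph := by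
    rw [← LinearPMap.isSelfAdjoint_def.mp hH]
    exact (LinearPMap.mem_graph_iff _).mpr ⟨⟨_, hmem⟩, rfl, hval⟩
  obtain ⟨z, hz1, hz2⟩ := LinearPMap.mem_graph_iff H |>.mp hgr
  have h2 := hR.2 z
  simp only at hz1 hz2
  rw [hz1, hz2] at h2
  have h3 : φ + Complex.I • star R φ - -Complex.I • star R φ
      = φ + (2 * Complex.I) • star R φ := by module
  rw [h3, map_add, map_smul] at h2
  simp only [sub_apply, smul_apply,
    mul_apply_eq_comp]
  nth_rewrite 1 [← h2]
  module

/-- The two resolvent identities have the same left side, so `R*R = RR*`. -/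
theorem isStarNormal_resolvent (hH : IsSelfAdjoint H) {R : F →L[ℂ] F}
    (hR : IsResolventAt H (-Complex.I) R) : IsStarNormal R := by
  refine ⟨?_⟩
  have h := (resolvent_sub_star hH hR).symm.trans (resolvent_sub_star' hH hR)
  exact smul_right_injective _ (by simp [Complex.I_ne_zero]) h

/-- The spectrum of `(H + i)⁻¹` consists of points `(E + i)⁻¹` and possibly `0`. -/
theorem im_inv_of_mem_spectrum (hH : IsSelfAdjoint H) {R : F →L[ℂ] F}
    (hR : IsResolventAt H (-Complex.I) R) {z : ℂ} (hz : z ∈ spectrum ℂ R) (hz0 : z ≠ 0) :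
    (z⁻¹).im = 1 := by
  have hn := isStarNormal_resolvent hH hR
  -- The resolvent identity is an equality of two functions of `R`, hence of the functions on the
  -- spectrum: `z - z̄ = -2i|z|²`.
  have h1 : cfc (fun z : ℂ => z - star z) R
      = cfc (fun z : ℂ => (-(2 * Complex.I)) • (star z * z)) R := by
    rw [cfc_sub (fun z : ℂ => z) (fun z : ℂ => star z) R, cfc_smul _ (fun z : ℂ => star z * z) R,
      cfc_mul (fun z : ℂ => star z) (fun z : ℂ => z) R, cfc_star_id (R := ℂ) (a := R) (ha := hn), cfc_id' ℂ R]
    exact resolvent_sub_star hH hR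
  have h2 := eqOn_of_cfc_eq_cfc h1 (by fun_prop) (by fun_prop) hn hz
  have h3 := congrArg Complex.im h2
  simp at h3
  have h4 : Complex.normSq z ≠ 0 := by simpa using hz0
  rw [Complex.inv_im, div_eq_one_iff_eq h4, Complex.normSq_apply]
  linarith

/-- Only `z = 0` is delicate: points of the spectrum near `0` are `(E + i)⁻¹` with `|E|` large,
where `f` vanishes. -/
theorem continuousOn_cutoff_inv (hH : IsSelfAdjoint H) {R : F →L[ℂ] F}
    (hR : IsResolventAt H (-Complex.I) R) {f : ℝ → ℂ} (hf : Continuous f)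
    (hfc : HasCompactSupport f) :
    ContinuousOn (fun z : ℂ => if z = 0 then 0 else f (z⁻¹).re) (spectrum ℂ R) := by
  intro z hz
  by_cases hz0 : z = 0
  · subst hz0
    obtain ⟨M, hM⟩ := hfc.isBounded.exists_norm_le
    have hev : (fun z : ℂ => if z = 0 then 0 else f (z⁻¹).re) =ᶠ[𝓝[spectrum ℂ R] 0]
        fun _ => (0 : ℂ) := by
      -- If `f(E) ≠ 0` then `|E| ≤ |M|`, so `|E + i| ≤ |M| + 1` and `(E + i)⁻¹` is outside this
      -- ball.
      have hb : Metric.ball (0 : ℂ) (1 / (|M| + 2)) ∈ 𝓝 (0 : ℂ) :=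
        Metric.ball_mem_nhds _ (by positivity)
      filter_upwards [self_mem_nhdsWithin, mem_nhdsWithin_of_mem_nhds hb] with w hw hwb
      by_cases hw0 : w = 0
      · simp [hw0]
      · rw [if_neg hw0]
        by_contra hne
        have h1 := hM _ (subset_tsupport f hne)
        have h2 := im_inv_of_mem_spectrum hH hR hw hw0
        have h3 := Complex.norm_le_abs_re_add_abs_im (w⁻¹)
        rw [h2, norm_inv] at h3
        rw [mem_ball_zero_iff, lt_div_iff₀ (by positivity)] at hwb
        have h4 : 0 < ‖w‖ := norm_pos_iff.mpr hw0
        have h5 : ‖w‖⁻¹ * ‖w‖ = 1 := inv_mul_cancel₀ h4.ne'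
        rw [Real.norm_eq_abs] at h1
        have h6 : ‖w‖⁻¹ ≤ |M| + 1 := by
          have := le_abs_self M
          rw [abs_one] at h3
          linarith
        nlinarith
    exact (continuousWithinAt_const.congr_of_eventuallyEq hev (by simp))
  · have hne : ∀ᶠ w in 𝓝 z, (fun z : ℂ => if z = 0 then 0 else f (z⁻¹).re) w = f (w⁻¹).re := by
      filter_upwards [isOpen_ne.mem_nhds hz0] with w hw
      exact if_neg hw
    refine ContinuousAt.continuousWithinAt (ContinuousAt.congr_of_eventuallyEq ?_ hne)
    exact hf.continuousAt.comp (Complex.continuous_re.continuousAt.comp (continuousAt_inv₀ hz0))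

omit [CompleteSpace F] in
theorem resolvent_apply_eigenvector {R : F →L[ℂ] F}
    (hR : IsResolventAt H (-Complex.I) R) {E : ℝ} {ψ : F} (hψ : ψ ∈ eigenspace H E) :
    R ψ = ((E : ℂ) + Complex.I)⁻¹ • ψ := by
  obtain ⟨h, h'⟩ := mem_eigenspace.mp hψ
  have h1 := hR.2 ⟨ψ, h⟩
  have h2 : (E : ℂ) + Complex.I ≠ 0 := fun h0 => by simpa using congrArg Complex.im h0
  rw [h', show (E : ℂ) • ψ - -Complex.I • ψ = ((E : ℂ) + Complex.I) • ψ by module,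
    map_smul] at h1
  rw [eq_inv_smul_iff₀ h2]
  exact h1

theorem inner_funcCalc_eigenvector (hH : IsSelfAdjoint H) {f : ℝ → ℂ} (hf : Continuous f)
    (hfc : HasCompactSupport f) {E : ℝ} {ψ : F} (hψ : ψ ∈ eigenspace H E) (u : F) :
    inner ℂ ψ (funcCalc H f u) = f E * inner ℂ ψ u := by
  by_cases hψ0 : ψ = 0
  · simp [hψ0]
  have hR := resolventAt_spec hH
  have hn := isStarNormal_resolvent hH hR
  have hE := resolvent_apply_eigenvector hR hψ
  have h2 : (E : ℂ) + Complex.I ≠ 0 := fun h0 => by simpa using congrArg Complex.im h0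
  -- Moving `f(H)` to the left turns it into the calculus of the conjugate function, which acts on
  -- the eigenvector by a scalar.
  rw [← ContinuousLinearMap.adjoint_inner_left, ← ContinuousLinearMap.star_eq_adjoint, funcCalc,
    ← cfc_star, cfc_apply_eigenvector (g := fun z : ℂ => star (if z = 0 then 0 else f (z⁻¹).re))
      hn hψ0 hE (continuous_star.comp_continuousOn (continuousOn_cutoff_inv hH hR hf hfc)),
    if_neg (inv_ne_zero h2), inner_smul_left]
  simp

/-- The closed eigenspaces of `H`, whose orthogonal projections are the operators `eigenproj H E`. -/
abbrev closedEigenspace (H : F →ₗ.[ℂ] F) (E : ℝ) : Submodule ℂ F :=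
  (eigenspace H E).topologicalClosure

theorem orthogonalFamily_closedEigenspace (hH : IsSelfAdjoint H) :
    OrthogonalFamily ℂ (fun E => closedEigenspace H E) fun E => (closedEigenspace H E).subtypeₗᵢ := by
  refine OrthogonalFamily.of_pairwise fun E E' hEE => ?_
  rw [Function.onFun, Submodule.isOrtho_iff_inner_eq] 
  have h0 : ∀ φ ∈ eigenspace H E, ∀ ψ ∈ eigenspace H E', inner ℂ φ ψ = 0 := by
    intro φ hφ ψ hψ
    obtain ⟨h, h'⟩ := mem_eigenspace.mp hφ
    obtain ⟨k, k'⟩ := mem_eigenspace.mp hψ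
    have hs := inner_apply_comm hH ⟨φ, h⟩ ⟨ψ, k⟩
    rw [h', k', inner_smul_left, inner_smul_right, Complex.conj_ofReal] at hs
    have h3 : ((E : ℂ) - E') * inner ℂ φ ψ = 0 := by
      simp only at hs
      linear_combination hs
    rcases mul_eq_zero.mp h3 with h4 | h4
    · exact absurd (by exact_mod_cast sub_eq_zero.mp h4) hEE
    · exact h4
  have h1 : ∀ φ ∈ closedEigenspace H E, ∀ ψ ∈ eigenspace H E', inner ℂ φ ψ = 0 := by
    intro φ hφ ψ hψ
    have hc : IsClosed {φ : F | inner ℂ φ ψ = 0} := isClosed_eq (by fun_prop) (by fun_prop)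
    exact closure_minimal (fun φ hφ => h0 φ hφ ψ hψ) hc hφ
  intro φ hφ ψ hψ
  have hc : IsClosed {ψ : F | inner ℂ φ ψ = 0} := isClosed_eq (by fun_prop) (by fun_prop)
  exact closure_minimal (fun ψ hψ => h1 φ hφ ψ hψ) hc hψ

theorem eigenproj_funcCalc (hH : IsSelfAdjoint H) {f : ℝ → ℂ} (hf : Continuous f)
    (hfc : HasCompactSupport f) (E : ℝ) (u : F) :
    eigenproj H E (funcCalc H f u) = f E • eigenproj H E u := by
  have hmem : ∀ v, eigenproj H E v ∈ closedEigenspace H E := fun v =>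
    Submodule.starProjection_apply_mem _ v
  have h1 : ∀ ψ ∈ closedEigenspace H E,
      inner ℂ ψ (eigenproj H E (funcCalc H f u)) = inner ℂ ψ (f E • eigenproj H E u) := by
    intro ψ hψ
    have hc : IsClosed {ψ : F | inner ℂ ψ (funcCalc H f u) = inner ℂ ψ (f E • u)} :=
      isClosed_eq (by fun_prop) (by fun_prop)
    have h2 : inner ℂ ψ (funcCalc H f u) = inner ℂ ψ (f E • u) := by
      refine closure_minimal (fun ψ hψ => ?_) hc hψ
      change inner ℂ ψ (funcCalc H f u) = inner ℂ ψ (f E • u)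
      rw [inner_funcCalc_eigenvector hH hf hfc hψ, inner_smul_right]
    have hp : ∀ v, inner ℂ ψ (eigenproj H E v) = inner ℂ ψ v := fun v => by
      rw [eigenproj, ← Submodule.inner_starProjection_left_eq_right,
        Submodule.starProjection_eq_self_iff.mpr hψ]
    rw [inner_smul_right, hp, hp, h2, inner_smul_right]
  -- The difference of the two sides lies in the closed eigenspace and is orthogonal to it.
  rw [← sub_eq_zero, ← inner_self_eq_zero (𝕜 := ℂ), inner_sub_right, h1, sub_self]
  exact Submodule.sub_mem _ (hmem _) (Submodule.smul_mem _ _ (hmem _))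

theorem eigenproj_apply_inner (E : ℝ) (u v : F) :
    inner ℂ (eigenproj H E u) v = inner ℂ (eigenproj H E u) (eigenproj H E v) := by
  have h : eigenproj H E (eigenproj H E u) = eigenproj H E u :=
    Submodule.starProjection_eq_self_iff.mpr (Submodule.starProjection_apply_mem _ u)
  conv_lhs => rw [← h]
  exact Submodule.inner_starProjection_left_eq_right _ _ _

/-- Bessel's inequality for the spectral projections. -/
theorem sum_norm_sq_eigenproj_le (hH : IsSelfAdjoint H) (s : Finset ℝ) (u : F) :
    ∑ E ∈ s, ‖eigenproj H E u‖ ^ 2 ≤ ‖u‖ ^ 2 := by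
  have h1 := (orthogonalFamily_closedEigenspace hH).norm_sum
    (fun E => ⟨eigenproj H E u, Submodule.starProjection_apply_mem _ u⟩) s
  simp only [Submodule.coe_subtypeₗᵢ, Submodule.subtype_apply, Submodule.coe_norm] at h1
  have h2 : inner ℂ (∑ E ∈ s, eigenproj H E u) u
      = ((∑ E ∈ s, ‖eigenproj H E u‖ ^ 2 : ℝ) : ℂ) := by
    rw [sum_inner]
    push_cast
    refine Finset.sum_congr rfl fun E _ => ?_
    rw [eigenproj_apply_inner, inner_self_eq_norm_sq_to_K]
    rfl
  have h3 := norm_inner_le_norm (𝕜 := ℂ) (∑ E ∈ s, eigenproj H E u) u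
  rw [h2, Complex.norm_real, Real.norm_of_nonneg (by positivity), ← h1] at h3
  rw [← h1]
  nlinarith [norm_nonneg (∑ E ∈ s, eigenproj H E u), norm_nonneg u,
    sq_nonneg (‖∑ E ∈ s, eigenproj H E u‖ - ‖u‖)]

/-- In an interval of pure point spectrum the functional calculus is the sum over eigenvalues. -/
theorem hasSum_funcCalc (hH : IsSelfAdjoint H) {I : Set ℝ} (hpp : HasPurePointSpectrumIn H I)
    {f : ℝ → ℂ} (hf : Continuous f) (hfc : HasCompactSupport f) (hfI : tsupport f ⊆ I) (u : F) :
    HasSum (fun E : ℝ => f E • eigenproj H E u) (funcCalc H f u) := by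
  have hmem : funcCalc H f u ∈ (⨆ E, closedEigenspace H E).topologicalClosure := by
    refine Submodule.topologicalClosure_mono ?_ (hpp f hf hfc hfI u)
    exact iSup₂_le fun E _ => (Submodule.le_topologicalClosure _).trans
      (le_iSup (fun E => closedEigenspace H E) E)
  have hV := orthogonalFamily_closedEigenspace hH
  have hr := hV.range_linearIsometry
  simp only [Submodule.subtypeₗᵢ_toLinearMap, Submodule.range_subtype] at hr
  rw [← hr] at hmem
  obtain ⟨w, hw⟩ := hmem
  have hs := hV.hasSum_linearIsometry w
  change HasSum _ (hV.linearIsometry w) at hs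
  have hw' : hV.linearIsometry w = funcCalc H f u := hw
  rw [hw'] at hs
  suffices h : (fun E => f E • eigenproj H E u) = fun E => (w E : F) by
    rw [h]
    exact hs
  funext E
  -- Applying `P_E` to the orthogonal expansion of `f(H)u` isolates its component at `E`, which must
  -- therefore be `f(E) P_E u`.
  rw [← eigenproj_funcCalc hH hf hfc]
  have h1 := hs.mapL (eigenproj H E)
  have h2 : eigenproj H E (w E) = w E := Submodule.starProjection_eq_self_iff.mpr (w E).2
  refine (h1.unique ?_).trans h2
  refine hasSum_single E fun E' hE' => ?_
  refine (Submodule.starProjection_apply_eq_zero_iff _).mpr ?_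
  intro v hv
  exact hV (Ne.symm hE') ⟨v, hv⟩ (w E')

end Operators

/-! ### Matrix elements in the canonical basis and summability of subexponential weights. -/

section Lattice

variable {V : Type*}

theorem inner_delta_left (v : V) (f : L2 V) : inner ℂ (delta v) f = f v := by
  classical
  have := lp.inner_single_left (𝕜 := ℂ) (G := fun _ : V => ℂ) v (1 : ℂ) f
  rw [delta]
  convert this using 1
  simp

theorem norm_delta (v : V) : ‖delta v‖ = 1 := by
  classical
  rw [delta, lp.norm_single (by norm_num), norm_one]

theorem inner_delta_delta_of_ne {v w : V} (h : v ≠ w) : inner ℂ (delta v) (delta w) = 0 := by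
  classical
  rw [inner_delta_left, delta, lp.single_apply_ne _ _ _ h]

/-- Parseval's identity in the canonical basis. -/
theorem tsum_enorm_inner_delta_sq (f : L2 V) :
    ∑' v, ‖inner ℂ (delta v) f‖ₑ ^ 2 = ‖f‖ₑ ^ 2 := by
  have h := lp.hasSum_norm (p := 2) (by norm_num) f
  simp only [ENNReal.toReal_ofNat, Real.rpow_ofNat] at h
  have h2 := ENNReal.ofReal_tsum_of_nonneg (fun v => sq_nonneg ‖f v‖) h.summable
  rw [h.tsum_eq] at h2
  rw [← ofReal_norm, ← ENNReal.ofReal_pow (norm_nonneg _), h2]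
  refine tsum_congr fun v => ?_
  rw [inner_delta_left, ← ofReal_norm, ENNReal.ofReal_pow (norm_nonneg _)]

/-- The Hilbert-Schmidt norm of `A` between two sites is the modulus of its matrix element. -/
theorem hsNorm_chi_comp_chi (A : L2 V →L[ℂ] L2 V) (x u : V) :
    hsNorm (chi x ∘L A ∘L chi u) = ‖inner ℂ (delta x) (A (delta u))‖ₑ := by
  have hd : ∀ v : V, inner ℂ (delta v) (delta v) = (1 : ℂ) := fun v => by
    rw [inner_self_eq_norm_sq_to_K, norm_delta]
    simp
  have hn : ‖delta x‖ₑ = 1 := by rw [← ofReal_norm, norm_delta, ENNReal.ofReal_one]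
  rw [hsNorm, tsum_eq_single u]
  · simp only [ContinuousLinearMap.comp_apply, chi, InnerProductSpace.rankOne_apply, hd, one_smul,
      enorm_smul, hn, mul_one]
    rw [← ENNReal.rpow_natCast_mul]
    norm_num
  · intro v hv
    simp [chi, inner_delta_delta_of_ne hv.symm]

theorem summable_exp_rpow_sub {β ζ a : ℝ} (hβ0 : 0 ≤ β) (hβζ : β < ζ) (ha : 0 < a) :
    Summable fun L : ℕ => Real.exp ((L : ℝ) ^ β - a * (L : ℝ) ^ ζ) := by
  have hζ : 0 < ζ := hβ0.trans_lt hβζ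
  have h1 : ∀ᶠ x : ℝ in atTop, x ^ β ≤ a / 2 * x ^ ζ := by
    have ht := (tendsto_rpow_atTop (sub_pos.mpr hβζ)).eventually_ge_atTop (2 / a)
    filter_upwards [ht, eventually_gt_atTop 0] with x hx hx0
    have h2 : x ^ ζ = x ^ (ζ - β) * x ^ β := by rw [← Real.rpow_add hx0]; ring_nf
    rw [h2, ← mul_assoc]
    refine le_mul_of_one_le_left (by positivity) ?_
    rw [div_le_iff₀ ha] at hx
    linarith
  -- Half of `a x^ζ` absorbs `x^β`. The exponent `-2/ζ`, evaluated at `x^ζ`, makes the remaining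
  -- exponential smaller than `x^{-2}`.
  have h2 := (isLittleO_exp_neg_mul_rpow_atTop (half_pos ha) (-2 / ζ)).comp_tendsto
    (tendsto_rpow_atTop hζ)
  have h3 : (fun x : ℝ => Real.exp (x ^ β - a * x ^ ζ)) =O[atTop] fun x : ℝ => x ^ (-2 : ℝ) := by
    refine (Asymptotics.IsBigO.of_bound 1 ?_).trans (h2.isBigO.congr' .rfl ?_)
    · filter_upwards [h1] with x hx
      simp only [Function.comp, Real.norm_eq_abs, Real.abs_exp, one_mul]
      exact Real.exp_le_exp.mpr (by linarith)
    · filter_upwards [eventually_ge_atTop 0] with x hx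
      simp only [Function.comp]
      rw [← Real.rpow_mul hx]
      congr 1
      field_simp
  exact summable_of_isBigO_nat (Real.summable_nat_rpow.mpr (by norm_num))
    (h3.comp_tendsto tendsto_natCast_atTop_atTop)

/-- On a graph whose spheres grow slower than `e^{L^β}`, subexponential weights with a larger
exponent are summable, uniformly in the base point. -/
theorem exists_tsum_exp_neg_dist_le (G : SimpleGraph V) {β ζ K : ℝ} (hβ0 : 0 ≤ β) (hβζ : β < ζ)
    (hvol : ∀ L : ℕ, (⨆ u : V, sphereCard G u L) ≤ ENNReal.ofReal (K * Real.exp ((L : ℝ) ^ β)))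
    {a : ℝ} (ha : 0 < a) :
    ∃ S : ℝ, 0 < S ∧ ∀ u : V,
      ∑' v, ENNReal.ofReal (Real.exp (-(a * (G.dist u v : ℝ) ^ ζ))) ≤ ENNReal.ofReal S := by
  have hs := (summable_exp_rpow_sub hβ0 hβζ ha).mul_left |K|
  -- The added `1` only makes the bound strictly positive, so that it can be inverted later.
  refine ⟨∑' L : ℕ, |K| * Real.exp ((L : ℝ) ^ β - a * (L : ℝ) ^ ζ) + 1, ?_, fun u => ?_⟩
  · exact add_pos_of_nonneg_of_pos (tsum_nonneg fun L => by positivity) one_pos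
  refine le_trans ?_ (ENNReal.ofReal_le_ofReal (le_add_of_nonneg_right zero_le_one))
  rw [ENNReal.ofReal_tsum_of_nonneg (fun L => by positivity) hs,
    ← ENNReal.tsum_fiberwise _ (fun v => G.dist u v)]
  refine ENNReal.tsum_le_tsum fun L => ?_
  have h1 : ∀ v : (fun v => G.dist u v) ⁻¹' {L},
      ENNReal.ofReal (Real.exp (-(a * (G.dist u v : ℝ) ^ ζ)))
        = ENNReal.ofReal (Real.exp (-(a * (L : ℝ) ^ ζ))) := by
    rintro ⟨v, hv⟩
    simp only [Set.mem_preimage, Set.mem_singleton_iff] at hv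
    rw [hv]
  rw [tsum_congr h1, ENNReal.tsum_const]
  have h2 : (ENat.card ((fun v => G.dist u v) ⁻¹' {L}) : ℝ≥0∞)
      ≤ ENNReal.ofReal (|K| * Real.exp ((L : ℝ) ^ β)) :=
    ((le_iSup (fun u => sphereCard G u L) u).trans (hvol L)).trans
      (ENNReal.ofReal_le_ofReal (by gcongr; exact le_abs_self K))
  calc _ ≤ ENNReal.ofReal (|K| * Real.exp ((L : ℝ) ^ β))
        * ENNReal.ofReal (Real.exp (-(a * (L : ℝ) ^ ζ))) := by gcongr
    _ = _ := by
      rw [← ENNReal.ofReal_mul (by positivity), mul_assoc, ← Real.exp_add, ← sub_eq_add_neg]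

end Lattice

/-! ### From decay of the spectral projections to summable eigenfunction correlators. -/

section Correlators

/-- If `∑ m = w`, where `m ≤ q w` and `m ≤ κ r` with `∑ κ ≤ 1/2`, then at least half of `w` sits on
`{w ≤ r}`, so that `w ^ s` is controlled by the sum of `q r ^ s`. -/
theorem rpow_le_two_mul_tsum {V : Type*} {m q κ r : V → ℝ≥0∞} {w : ℝ≥0∞} (hm : ∑' y, m y = w)
    (hw : w ≠ ⊤) (hq : ∀ y, m y ≤ q y * w) (hb : ∀ y, m y ≤ κ y * r y) (hκ : ∑' y, κ y ≤ 2⁻¹)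
    {s : ℝ} (hs : 0 < s) : w ^ s ≤ 2 * ∑' y, q y * r y ^ s := by
  classical
  by_cases hw0 : w = 0
  · simp [hw0, hs]
  set T : ℝ≥0∞ := ∑' y, if w ≤ r y then q y else 0 with hT
  -- Sites with `r y < w` contribute at most `κ y * w`, the others at most `q y * w`.
  have h1 : w ≤ (∑' y, κ y + T) * w := by
    rw [hT, ← ENNReal.tsum_add, ← ENNReal.tsum_mul_right]
    conv_lhs => rw [← hm]
    refine ENNReal.tsum_le_tsum fun y => ?_
    split_ifs with h
    · exact (hq y).trans (by gcongr; exact le_add_self)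
    · exact (hb y).trans (by rw [add_zero]; gcongr; exact (not_le.mp h).le)
  have h2 : 2⁻¹ ≤ T := by
    by_contra hlt
    have h3 : ∑' y, κ y + T < 1 := by
      rw [← ENNReal.inv_two_add_inv_two]
      exact ENNReal.add_lt_add_of_le_of_lt (ne_top_of_le_ne_top (by simp) hκ) hκ (not_le.mp hlt)
    have h4 := ENNReal.mul_lt_mul_left hw0 hw h3
    rw [one_mul] at h4
    exact absurd h1 (not_le.mpr h4)
  calc w ^ s = 2 * (2⁻¹ * w ^ s) := by
        rw [← mul_assoc, ENNReal.mul_inv_cancel (by simp) (by simp), one_mul]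
    _ ≤ 2 * (T * w ^ s) := by gcongr
    _ ≤ 2 * ∑' y, q y * r y ^ s := by
      rw [hT, ← ENNReal.tsum_mul_right]
      refine mul_le_mul' le_rfl (ENNReal.tsum_le_tsum fun y => ?_)
      split_ifs with h
      · gcongr
      · simp

/-- The one-index bound is linear in `q`, so after exchanging the sums the hypothesis `∑ q ≤ 1`,
Bessel's inequality in the application, removes the index. -/
theorem sum_rpow_le_two_mul_tsum {V ι : Type*} (F : Finset ι) {m q : ι → V → ℝ≥0∞}
    {κ r : V → ℝ≥0∞} {w : ι → ℝ≥0∞} (hm : ∀ i, ∑' y, m i y = w i)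
    (hw : ∀ i, w i ≠ ⊤) (hq : ∀ i y, m i y ≤ q i y * w i) (hb : ∀ i y, m i y ≤ κ y * r y)
    (hκ : ∑' y, κ y ≤ 2⁻¹) (hF : ∀ y, ∑ i ∈ F, q i y ≤ 1) {s : ℝ} (hs : 0 < s) :
    ∑ i ∈ F, w i ^ s ≤ 2 * ∑' y, r y ^ s := by
  calc ∑ i ∈ F, w i ^ s ≤ ∑ i ∈ F, 2 * ∑' y, q i y * r y ^ s :=
        Finset.sum_le_sum fun i _ => rpow_le_two_mul_tsum (hm i) (hw i) (hq i) (hb i) hκ hs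
    _ = 2 * ∑' y, (∑ i ∈ F, q i y) * r y ^ s := by
      rw [← Finset.mul_sum, ← Summable.tsum_finsetSum fun i _ => ENNReal.summable]
      simp_rw [Finset.sum_mul]
    _ ≤ 2 * ∑' y, r y ^ s := by
      gcongr with y
      exact (mul_le_mul_left (hF y) _).trans_eq (one_mul _)

variable {V : Type*} {H : L2 V →ₗ.[ℂ] L2 V}

theorem enorm_inner_delta_le (v : V) (f : L2 V) : ‖inner ℂ (delta v) f‖ₑ ≤ ‖f‖ₑ := by
  have h := norm_inner_le_norm (𝕜 := ℂ) (delta v) f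
  rw [norm_delta, one_mul] at h
  rw [← ofReal_norm, ← ofReal_norm]
  exact ENNReal.ofReal_le_ofReal h

theorem enorm_inner_delta_eigenproj_le (E : ℝ) (x u : V) :
    ‖inner ℂ (delta x) (eigenproj H E (delta u))‖ₑ
      ≤ ‖eigenproj H E (delta x)‖ₑ * ‖eigenproj H E (delta u)‖ₑ := by
  have h1 : inner ℂ (delta x) (eigenproj H E (delta u))
      = inner ℂ (eigenproj H E (delta x)) (eigenproj H E (delta u)) := by
    rw [← inner_conj_symm, eigenproj_apply_inner, inner_conj_symm]
  have h := norm_inner_le_norm (𝕜 := ℂ) (eigenproj H E (delta x)) (eigenproj H E (delta u))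
  rw [h1, ← ofReal_norm, ← ofReal_norm, ← ofReal_norm, ← ENNReal.ofReal_mul (norm_nonneg _)]
  exact ENNReal.ofReal_le_ofReal h

theorem sum_enorm_sq_eigenproj_delta_le (hH : IsSelfAdjoint H) (F : Finset ℝ) (y : V) :
    ∑ E ∈ F, ‖eigenproj H E (delta y)‖ₑ ^ 2 ≤ 1 := by
  have h := sum_norm_sq_eigenproj_le hH F (delta y)
  rw [norm_delta, one_pow] at h
  simp_rw [← ofReal_norm, ← ENNReal.ofReal_pow (norm_nonneg _)]
  rw [← ENNReal.ofReal_sum_of_nonneg fun E _ => by positivity, ← ENNReal.ofReal_one]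
  exact ENNReal.ofReal_le_ofReal h

/-- Decay of the matrix elements of the spectral projections away from `u` bounds fractional moments
of the spectral weights at `u`. -/
theorem sum_rpow_weight_le (hH : IsSelfAdjoint H) {X : ℝ → ℝ} {u : V} {g : V → ℝ} {c S : ℝ}
    (hc : 0 ≤ c) (hg : ∀ y, 0 ≤ g y) (hS : 0 < S)
    (hgS : ∑' y, ENNReal.ofReal (g y) ≤ ENNReal.ofReal S)
    (hdec : ∀ E y, ENNReal.ofReal (X E) * ‖inner ℂ (delta y) (eigenproj H E (delta u))‖ₑ
      ≤ ENNReal.ofReal (c * g y)) (F : Finset ℝ) {s : ℝ} (hs : 0 < s) :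
    ∑ E ∈ F, ((ENNReal.ofReal (X E) * ‖eigenproj H E (delta u)‖ₑ) ^ 2) ^ s
      ≤ 2 * ∑' y, ENNReal.ofReal (2 * S * c ^ 2 * g y) ^ s := by
  -- The squared decay bound `(c g)²` is split as `κ r` with `κ = g / (2S)`, of total mass at most
  -- `1/2`, and `r = 2S c² g`.
  refine sum_rpow_le_two_mul_tsum F
    (m := fun E y => (ENNReal.ofReal (X E) * ‖inner ℂ (delta y) (eigenproj H E (delta u))‖ₑ) ^ 2)
    (q := fun E y => ‖eigenproj H E (delta y)‖ₑ ^ 2)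
    (κ := fun y => ENNReal.ofReal ((2 * S)⁻¹) * ENNReal.ofReal (g y)) ?_ ?_ ?_ ?_ ?_ ?_ hs
  · intro E
    simp_rw [mul_pow, ENNReal.tsum_mul_left, tsum_enorm_inner_delta_sq]
  · intro E
    finiteness
  · intro E y
    calc _ ≤ (ENNReal.ofReal (X E)
          * (‖eigenproj H E (delta y)‖ₑ * ‖eigenproj H E (delta u)‖ₑ)) ^ 2 := by
          gcongr
          exact enorm_inner_delta_eigenproj_le E y u
      _ = _ := by ring
  · intro E y
    calc _ ≤ ENNReal.ofReal (c * g y) ^ 2 := by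
          gcongr
          exact hdec E y
      _ = _ := by
        have := hg y
        rw [← ENNReal.ofReal_pow (by positivity), ← ENNReal.ofReal_mul (by positivity),
          ← ENNReal.ofReal_mul (by positivity)]
        congr 1
        field_simp
  · rw [ENNReal.tsum_mul_left]
    calc _ ≤ ENNReal.ofReal ((2 * S)⁻¹) * ENNReal.ofReal S := by gcongr
      _ = 2⁻¹ := by
        rw [← ENNReal.ofReal_mul (by positivity)]
        have : (2 * S)⁻¹ * S = (2 : ℝ)⁻¹ := by field_simp
        rw [this, ENNReal.ofReal_inv_of_pos two_pos]
        simp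
  · exact fun y => sum_enorm_sq_eigenproj_delta_le hH F y

/-- The eigenfunction correlator inherits the square root of the decay of the matrix elements of the
spectral projections. -/
theorem sum_correlator_le (hH : IsSelfAdjoint H) {X : ℝ → ℝ} {u : V} {g : V → ℝ} {c S S' : ℝ}
    (hc : 0 ≤ c) (hg : ∀ y, 0 ≤ g y) (hS : 0 < S)
    (hgS : ∑' y, ENNReal.ofReal (g y) ≤ ENNReal.ofReal S)
    (hgS' : ∑' y, ENNReal.ofReal (g y ^ (1 / 4 : ℝ)) ≤ ENNReal.ofReal S')
    (hdec : ∀ E y, ENNReal.ofReal (X E) * ‖inner ℂ (delta y) (eigenproj H E (delta u))‖ₑ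
      ≤ ENNReal.ofReal (c * g y)) (F : Finset ℝ) (x : V) :
    ∑ E ∈ F, ENNReal.ofReal (X E) * ‖inner ℂ (delta x) (eigenproj H E (delta u))‖ₑ
      ≤ ENNReal.ofReal (2 * (2 * S) ^ (1 / 4 : ℝ) * S' * c * g x ^ (1 / 2 : ℝ)) := by
  have h1 : ∀ E, ENNReal.ofReal (X E) * ‖inner ℂ (delta x) (eigenproj H E (delta u))‖ₑ
      ≤ ENNReal.ofReal (c * g x) ^ (1 / 2 : ℝ) *
        ((ENNReal.ofReal (X E) * ‖eigenproj H E (delta u)‖ₑ) ^ 2) ^ (1 / 4 : ℝ) := by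
    intro E
    set a := ENNReal.ofReal (X E) * ‖inner ℂ (delta x) (eigenproj H E (delta u))‖ₑ with ha
    calc a = a ^ (1 / 2 : ℝ) * (a ^ 2) ^ (1 / 4 : ℝ) := by
          rw [← ENNReal.rpow_natCast_mul, ← ENNReal.rpow_add_of_nonneg _ _ (by norm_num) (by norm_num)]
          norm_num
      _ ≤ _ := by
        gcongr
        · exact hdec E x
        · rw [ha]
          gcongr
          exact enorm_inner_delta_le x _
  have h2 : ∑' y, ENNReal.ofReal (2 * S * c ^ 2 * g y) ^ (1 / 4 : ℝ)
      ≤ ENNReal.ofReal ((2 * S) ^ (1 / 4 : ℝ) * c ^ (1 / 2 : ℝ) * S') := by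
    have h3 : ∀ y, ENNReal.ofReal (2 * S * c ^ 2 * g y) ^ (1 / 4 : ℝ)
        = ENNReal.ofReal ((2 * S) ^ (1 / 4 : ℝ) * c ^ (1 / 2 : ℝ))
          * ENNReal.ofReal (g y ^ (1 / 4 : ℝ)) := by
      intro y
      have := hg y
      rw [ENNReal.ofReal_rpow_of_nonneg (by positivity) (by norm_num),
        Real.mul_rpow (by positivity) (by positivity), Real.mul_rpow (by positivity) (by positivity),
        ← Real.rpow_natCast_mul hc, ENNReal.ofReal_mul (by positivity)]
      norm_num
    rw [tsum_congr h3, ENNReal.tsum_mul_left, ENNReal.ofReal_mul (q := S') (by positivity)]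
    gcongr
  calc _ ≤ ∑ E ∈ F, ENNReal.ofReal (c * g x) ^ (1 / 2 : ℝ) *
        ((ENNReal.ofReal (X E) * ‖eigenproj H E (delta u)‖ₑ) ^ 2) ^ (1 / 4 : ℝ) :=
        Finset.sum_le_sum fun E _ => h1 E
    _ ≤ ENNReal.ofReal (c * g x) ^ (1 / 2 : ℝ)
        * (2 * ENNReal.ofReal ((2 * S) ^ (1 / 4 : ℝ) * c ^ (1 / 2 : ℝ) * S')) := by
      rw [← Finset.mul_sum]
      gcongr
      refine (sum_rpow_weight_le hH hc hg hS hgS hdec F (by norm_num)).trans ?_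
      gcongr
    _ = _ := by
      have hgx := hg x
      -- One root of `c` comes from each factor. The result is linear in `c`, which later preserves
      -- the factor `e^{ε|u|^ζ}` exactly.
      have h4 : c ^ (1 / 2 : ℝ) * c ^ (1 / 2 : ℝ) = c := by
        rw [← Real.rpow_add_of_nonneg hc (by norm_num) (by norm_num)]
        norm_num
      rw [ENNReal.ofReal_rpow_of_nonneg (by positivity) (by norm_num),
        Real.mul_rpow hc hgx, ← ENNReal.ofReal_ofNat, ← ENNReal.ofReal_mul (by positivity),
        ← ENNReal.ofReal_mul (by positivity)]
      congr 1
      linear_combination (2 * (2 * S) ^ (1 / 4 : ℝ) * S' * g x ^ (1 / 2 : ℝ)) * h4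

theorem norm_phase (t E : ℝ) : ‖Complex.exp (-(Complex.I * t * E))‖ = 1 := by
  rw [Complex.norm_exp]
  simp

/-- The matrix elements of `e^{-itH} X(H)` as sums over eigenvalues. -/
theorem hasSum_inner_evolution (hH : IsSelfAdjoint H) {I : Set ℝ} (hpp : HasPurePointSpectrumIn H I)
    {X : ℝ → ℝ} (hX : IsEnergyCutoff I X) (t : ℝ) (x u : V) :
    HasSum (fun E : ℝ => Complex.exp (-(Complex.I * t * E)) *
        ((X E : ℂ) * inner ℂ (delta x) (eigenproj H E (delta u))))
      (inner ℂ (delta x) (evolution H X t (delta u))) := by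
  have hXc : Continuous fun E => (X E : ℂ) := Complex.continuous_ofReal.comp hX.smooth.continuous
  have hsub : tsupport (fun E : ℝ => Complex.exp (-(Complex.I * t * E)) * (X E : ℂ)) ⊆ tsupport X := by
    refine closure_mono fun E hE hXE => hE ?_
    simp [hXE]
  have h := hasSum_funcCalc hH hpp (f := fun E => Complex.exp (-(Complex.I * t * E)) * (X E : ℂ))
    (by fun_prop) (hX.compact.of_isClosed_subset (isClosed_tsupport _) hsub)
    (hsub.trans hX.support) (delta u)
  have h2 := h.mapL (innerSL ℂ (delta x))
  simp only [innerSL_apply_apply, inner_smul_right] at h2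
  simpa only [mul_assoc, evolution] using h2

/-- The phases have modulus one, so a bound on the correlator holds for all times at once. -/
theorem enorm_inner_evolution_le (hH : IsSelfAdjoint H) {I : Set ℝ}
    (hpp : HasPurePointSpectrumIn H I) {X : ℝ → ℝ} (hX : IsEnergyCutoff I X) (t : ℝ) {x u : V}
    {B : ℝ≥0∞} (hB : ∀ F : Finset ℝ,
      ∑ E ∈ F, ENNReal.ofReal (X E) * ‖inner ℂ (delta x) (eigenproj H E (delta u))‖ₑ ≤ B) :
    ‖inner ℂ (delta x) (evolution H X t (delta u))‖ₑ ≤ B := by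
  have h : Tendsto _ atTop _ := hasSum_inner_evolution hH hpp hX t x u
  refine le_of_tendsto h.enorm (Eventually.of_forall fun F => ?_)
  refine (enorm_sum_le _ _).trans ((Finset.sum_le_sum fun E _ => ?_).trans (hB F))
  rw [enorm_mul, enorm_mul, ← ofReal_norm (Complex.exp _), norm_phase, ENNReal.ofReal_one, one_mul,
    ← ofReal_norm (X E : ℂ), Complex.norm_real, Real.norm_of_nonneg (hX.nonneg E)]

theorem SULP.sudl {G : SimpleGraph V} {o : V} {β ζ K : ℝ} (hβ0 : 0 ≤ β) (hβζ : β < ζ)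
    (hvol : ∀ L : ℕ, (⨆ u : V, sphereCard G u L) ≤ ENNReal.ofReal (K * Real.exp ((L : ℝ) ^ β)))
    (hH : IsSelfAdjoint H) {I : Set ℝ} (hpp : HasPurePointSpectrumIn H I)
    (h : SULP G o H I ζ) : SUDL G o H I ζ := by
  obtain ⟨σ, hσ, h⟩ := h
  obtain ⟨S, hS, hgS⟩ := exists_tsum_exp_neg_dist_le G hβ0 hβζ hvol hσ
  -- The rate `σ / 4` is that of the fourth root of the decay `e^{-σ d^ζ}`.
  obtain ⟨S', -, hgS'⟩ := exists_tsum_exp_neg_dist_le G hβ0 hβζ hvol (a := σ / 4) (by positivity)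
  refine ⟨σ / 2, half_pos hσ, fun ε hε X hX => ?_⟩
  obtain ⟨C, hC⟩ := h ε hε X hX
  refine ⟨2 * (2 * S) ^ (1 / 4 : ℝ) * S' * |C|, fun x u => ?_⟩
  refine iSup_le fun t => ?_
  rw [hsNorm_chi_comp_chi]
  refine enorm_inner_evolution_le hH hpp hX t fun F => ?_
  have key := sum_correlator_le hH (X := X) (u := u) (S' := S')
    (g := fun y => Real.exp (-(σ * (G.dist y u : ℝ) ^ ζ)))
    (c := |C| * Real.exp (ε * (G.dist o u : ℝ) ^ ζ)) (by positivity) (fun y => (Real.exp_pos _).le)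
    hS ?_ ?_ ?_ F x
  · refine key.trans_eq ?_
    rw [← Real.exp_mul]
    congr 1
    rw [show -(σ * (G.dist x u : ℝ) ^ ζ) * (1 / 2) = -(σ / 2 * (G.dist x u : ℝ) ^ ζ) by ring]
    ring
  · simp_rw [G.dist_comm (v := u)]
    exact hgS u
  · simp_rw [← Real.exp_mul, G.dist_comm (v := u)]
    refine le_trans (le_of_eq (tsum_congr fun y => ?_)) (hgS' u)
    congr 2
    ring
  · intro E y
    have h1 := (le_iSup (fun E : ℝ => ENNReal.ofReal (X E) *
      hsNorm (chi y ∘L eigenproj H E ∘L chi u)) E).trans (hC y u)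
    rw [hsNorm_chi_comp_chi] at h1
    refine h1.trans (ENNReal.ofReal_le_ofReal ?_)
    gcongr
    exact le_abs_self C

end Correlators

open MeasureTheory

/-! ### Wiener-type averages and the remaining implications. -/

section TimeAverages

theorem norm_average_exp_le (s T : ℝ) (hT : 0 < T) :
    ‖(1 / T : ℂ) * ∫ t in (0 : ℝ)..T, Complex.exp (Complex.I * s * t)‖ ≤ 1 := by
  have h := intervalIntegral.norm_integral_le_of_norm_le_const (a := 0) (b := T) (C := 1)
    (f := fun t : ℝ => Complex.exp (Complex.I * s * t)) fun t _ => by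
      rw [Complex.norm_exp]
      simp
  rw [sub_zero, one_mul, abs_of_pos hT] at h
  rw [norm_mul, norm_div, norm_one, Complex.norm_real, Real.norm_of_nonneg hT.le, one_div,
    inv_mul_le_iff₀ hT, mul_one]
  exact h

theorem tendsto_average_exp (s : ℝ) :
    Tendsto (fun T : ℝ => (1 / T : ℂ) * ∫ t in (0 : ℝ)..T, Complex.exp (Complex.I * s * t)) atTop
      (𝓝 (if s = 0 then 1 else 0)) := by
  split_ifs with hs
  · refine tendsto_const_nhds.congr' ?_
    filter_upwards [eventually_gt_atTop 0] with T hT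
    have : (T : ℂ) ≠ 0 := by exact_mod_cast hT.ne'
    simp [hs, this]
  · have hc : Complex.I * s ≠ 0 := by simp [hs]
    have h1 : Tendsto (fun T : ℝ => 2 / |s| * T⁻¹) atTop (𝓝 0) := by
      simpa using tendsto_inv_atTop_zero.const_mul (2 / |s|)
    refine squeeze_zero_norm' ?_ h1
    filter_upwards [eventually_gt_atTop 0] with T hT
    rw [integral_exp_mul_complex hc, norm_mul, norm_div, norm_div, norm_mul, Complex.norm_I,
      Complex.norm_real, Complex.norm_real, norm_one, Real.norm_of_nonneg hT.le, one_mul,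
      Real.norm_eq_abs, one_div, mul_comm]
    gcongr
    refine (norm_sub_le _ _).trans (le_of_eq ?_)
    rw [Complex.norm_exp, Complex.norm_exp]
    simp
    norm_num

/-- The average of an absolutely convergent trigonometric series `∑ a_E e^{-itE}` against `e^{itE}`
recovers the coefficient `a_E`. -/
theorem tendsto_average_trigonometric {a : ℝ → ℂ} (ha : Summable a) {c : ℝ → ℂ}
    (hc : ∀ t : ℝ, HasSum (fun E : ℝ => Complex.exp (-(Complex.I * t * E)) * a E) (c t)) (E : ℝ) :
    Tendsto (fun T : ℝ => (1 / T : ℂ) *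
      ∫ t in (0 : ℝ)..T, Complex.exp (Complex.I * E * t) * c t) atTop (𝓝 (a E)) := by
  -- Exchanging the sum with the time integral needs a countable index set, hence the restriction to
  -- the support of `a`.
  have hcount : Countable (Function.support a) := ha.countable_support
  have hn : Summable fun i : Function.support a => ‖a i‖ := ha.norm.subtype _
  have hc' : ∀ t : ℝ, HasSum (fun i : Function.support a =>
      Complex.exp (Complex.I * (E - i : ℝ) * t) * a i) (Complex.exp (Complex.I * E * t) * c t) := by
    intro t
    have h := ((hasSum_subtype_iff_of_support_subset (s := Function.support a) (by
      intro E' hE'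
      exact right_ne_zero_of_mul hE')).mpr (hc t)).mul_left (Complex.exp (Complex.I * E * t))
    refine (congrArg (HasSum · _) (funext fun i => ?_)).mp h
    rw [Function.comp_apply, ← mul_assoc, ← Complex.exp_add]
    push_cast
    ring_nf
  have hint : ∀ T : ℝ, HasSum (fun i : Function.support a =>
      ((1 / T : ℂ) * ∫ t in (0 : ℝ)..T, Complex.exp (Complex.I * (E - i : ℝ) * t)) * a i)
      ((1 / T : ℂ) * ∫ t in (0 : ℝ)..T, Complex.exp (Complex.I * E * t) * c t) := by
    intro T
    have h := intervalIntegral.hasSum_integral_of_dominated_convergence (a := 0) (b := T)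
      (μ := volume) (F := fun (i : Function.support a) (t : ℝ) =>
        Complex.exp (Complex.I * (E - i : ℝ) * t) * a i)
      (f := fun t => Complex.exp (Complex.I * E * t) * c t) (fun i _ => ‖a i‖)
      (fun i => (by fun_prop : Continuous _).aestronglyMeasurable)
      (fun i => Eventually.of_forall fun t _ => by
        rw [norm_mul, Complex.norm_exp]
        simp)
      (Eventually.of_forall fun t _ => hn) (by simp) (Eventually.of_forall fun t _ => hc' t)
    simp only [intervalIntegral.integral_mul_const] at h
    simpa only [mul_assoc] using h.mul_left (1 / T : ℂ)
  have hlim := tendsto_tsum_of_dominated_convergence (𝓕 := atTop) (bound := fun i => ‖a i‖) hn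
    (f := fun (T : ℝ) (i : Function.support a) =>
      ((1 / T : ℂ) * ∫ t in (0 : ℝ)..T, Complex.exp (Complex.I * (E - i : ℝ) * t)) * a i)
    (g := fun i => (if E - i = 0 then 1 else 0) * a i)
    (fun i => (tendsto_average_exp (E - i)).mul_const _) (by
      filter_upwards [eventually_gt_atTop 0] with T hT i
      rw [norm_mul]
      exact mul_le_of_le_one_left (norm_nonneg _) (norm_average_exp_le _ T hT))
  have hval : ∑' i : Function.support a, (if E - i = 0 then 1 else 0) * a i = a E := by
    rw [tsum_subtype (Function.support a) fun E' => (if E - E' = 0 then 1 else 0) * a E',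
      tsum_eq_single E]
    · by_cases h : a E = 0 <;> simp [h]
    · intro E' hE'
      simp [sub_eq_zero, hE'.symm]
  rw [hval] at hlim
  exact hlim.congr fun T => (hint T).tsum_eq

/-- Uniform convergence of the series. Continuity is what allows lower Lebesgue integrals of `‖c‖²`
to be replaced by ordinary ones. -/
theorem continuous_trigonometric {a : ℝ → ℂ} (ha : Summable a) {c : ℝ → ℂ}
    (hc : ∀ t : ℝ, HasSum (fun E : ℝ => Complex.exp (-(Complex.I * t * E)) * a E) (c t)) :
    Continuous c := by
  have h : c = fun t : ℝ => ∑' E : ℝ, Complex.exp (-(Complex.I * t * E)) * a E :=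
    funext fun t => (hc t).tsum_eq.symm
  rw [h]
  refine continuous_tsum (fun E => by fun_prop) ha.norm fun E t => ?_
  rw [norm_mul, norm_phase, one_mul]

/-- A bound on the quadratic time averages of a trigonometric series bounds its coefficients. -/
theorem norm_sq_coeff_le_of_average_le {a : ℝ → ℂ} (ha : Summable a) {c : ℝ → ℂ}
    (hc : ∀ t : ℝ, HasSum (fun E : ℝ => Complex.exp (-(Complex.I * t * E)) * a E) (c t)) {b : ℝ}
    (hb0 : 0 ≤ b) (hb : ∀ T : ℝ, 0 < T →
      ENNReal.ofReal (1 / T) * ∫⁻ t in Set.Ioc 0 T, ‖c t‖ₑ ^ 2 ≤ ENNReal.ofReal b) (E : ℝ) :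
    ‖a E‖ ^ 2 ≤ b := by
  have hcont := continuous_trigonometric ha hc
  have hre : ∀ T : ℝ, 0 < T → 1 / T * ∫ t in (0 : ℝ)..T, ‖c t‖ ^ 2 ≤ b := by
    intro T hT
    have h1 : ∫⁻ t in Set.Ioc 0 T, ‖c t‖ₑ ^ 2 = ENNReal.ofReal (∫ t in (0 : ℝ)..T, ‖c t‖ ^ 2) := by
      rw [intervalIntegral.integral_of_le hT.le, ofReal_integral_eq_lintegral_ofReal]
      · refine lintegral_congr fun t => ?_
        rw [← ofReal_norm, ENNReal.ofReal_pow (norm_nonneg _)]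
      · exact (hcont.norm.pow 2).integrableOn_Ioc
      · exact Eventually.of_forall fun t => by positivity
    have h2 := hb T hT
    rwa [h1, ← ENNReal.ofReal_mul (by positivity), ENNReal.ofReal_le_ofReal_iff hb0] at h2
  set z := a E with hz
  -- This averages the inequality `0 ≤ |e^{iEt} c(t) - z|²`. As `T → ∞` its left side tends to
  -- `2|z|² - |z|² = |z|²`.
  have hlow : ∀ T : ℝ, 0 < T → 2 * (starRingEnd ℂ z * ((1 / T : ℂ) *
      ∫ t in (0 : ℝ)..T, Complex.exp (Complex.I * E * t) * c t)).re - ‖z‖ ^ 2 ≤ b := by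
    intro T hT
    refine le_trans ?_ (hre T hT)
    have hpt : ∀ t : ℝ, 2 * (starRingEnd ℂ z * (Complex.exp (Complex.I * E * t) * c t)).re - ‖z‖ ^ 2
        ≤ ‖c t‖ ^ 2 := by
      intro t
      have h1 : (starRingEnd ℂ z * (Complex.exp (Complex.I * E * t) * c t)).re ≤ ‖z‖ * ‖c t‖ := by
        refine (Complex.re_le_norm _).trans (le_of_eq ?_)
        rw [norm_mul, norm_mul, Complex.norm_exp]
        simp
      nlinarith [sq_nonneg (‖z‖ - ‖c t‖)]
    have hmono := intervalIntegral.integral_mono_on (μ := volume) hT.le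
      (f := fun t : ℝ => 2 * (starRingEnd ℂ z * (Complex.exp (Complex.I * E * t) * c t)).re - ‖z‖ ^ 2)
      (g := fun t => ‖c t‖ ^ 2) (Continuous.intervalIntegrable (by fun_prop) _ _)
      (Continuous.intervalIntegrable (by fun_prop) _ _) fun t _ => hpt t
    have heq : ∫ t in (0 : ℝ)..T,
        (2 * (starRingEnd ℂ z * (Complex.exp (Complex.I * E * t) * c t)).re - ‖z‖ ^ 2)
        = 2 * (starRingEnd ℂ z * ∫ t in (0 : ℝ)..T, Complex.exp (Complex.I * E * t) * c t).re
          - T * ‖z‖ ^ 2 := by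
      rw [intervalIntegral.integral_sub (Continuous.intervalIntegrable (by fun_prop) _ _)
        (Continuous.intervalIntegrable (by fun_prop) _ _), intervalIntegral.integral_const_mul,
        intervalIntegral.integral_const]
      have := Complex.reCLM.intervalIntegral_comp_comm (a := 0) (b := T) (μ := volume)
        (f := fun t : ℝ => starRingEnd ℂ z * (Complex.exp (Complex.I * E * t) * c t))
        (Continuous.intervalIntegrable (by fun_prop) _ _)
      simp only [Complex.reCLM_apply] at this
      rw [this, intervalIntegral.integral_const_mul]
      simp
    rw [heq] at hmono
    have hTT : (1 / T : ℂ) = ((1 / T : ℝ) : ℂ) := by push_cast; rfl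
    rw [hTT, mul_left_comm, Complex.re_ofReal_mul]
    have hmul := mul_le_mul_of_nonneg_left hmono (by positivity : 0 ≤ 1 / T)
    refine le_trans (le_of_eq ?_) hmul
    field_simp
  have hlim := (((tendsto_average_trigonometric ha hc E).const_mul (starRingEnd ℂ z)))
  have hlim2 := (((Complex.continuous_re.tendsto _).comp hlim).const_mul 2).sub_const (‖z‖ ^ 2)
  have hle := le_of_tendsto hlim2 (by
    filter_upwards [eventually_gt_atTop 0] with T hT
    exact hlow T hT)
  rw [← hz, Complex.conj_mul'] at hle
  have h5 : ((‖z‖ : ℂ) ^ 2).re = ‖z‖ ^ 2 := by norm_cast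
  rw [h5] at hle
  linarith

variable {V : Type*} {G : SimpleGraph V} {o : V} {H : L2 V →ₗ.[ℂ] L2 V} {I : Set ℝ} {ζ : ℝ}

theorem AveragedDL.sulp (hH : IsSelfAdjoint H) (hpp : HasPurePointSpectrumIn H I)
    (h : AveragedDL G o H I ζ) : SULP G o H I ζ := by
  obtain ⟨σ, hσ, h⟩ := h
  refine ⟨σ / 2, half_pos hσ, fun ε hε X hX => ?_⟩
  -- The moment controls the squared coefficient; the square root returns `ε` and halves `σ`.
  obtain ⟨C, hC⟩ := h (2 * ε) (by positivity) X hX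
  refine ⟨√|C|, fun x u => iSup_le fun E => ?_⟩
  rw [hsNorm_chi_comp_chi]
  have hs := fun t => hasSum_inner_evolution hH hpp hX t x u
  have ha : Summable fun E : ℝ => (X E : ℂ) * inner ℂ (delta x) (eigenproj H E (delta u)) := by
    simpa using (hs 0).summable
  set d : ℝ := (G.dist x u : ℝ) ^ ζ with hd
  set l : ℝ := (G.dist o u : ℝ) ^ ζ
  have hb := norm_sq_coeff_le_of_average_le ha hs
    (b := |C| * Real.exp (2 * ε * l) * Real.exp (-(σ * d))) (by positivity) (fun T hT => ?_) E
  · have h1 : ‖(X E : ℂ) * inner ℂ (delta x) (eigenproj H E (delta u))‖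
        ≤ √|C| * Real.exp (ε * l) * Real.exp (-(σ / 2 * d)) := by
      refine le_of_sq_le_sq (hb.trans_eq ?_) (by positivity)
      rw [mul_pow, mul_pow, Real.sq_sqrt (abs_nonneg C), ← Real.exp_nat_mul, ← Real.exp_nat_mul]
      congr 3 <;> push_cast <;> ring_nf
    rw [norm_mul, Complex.norm_real, Real.norm_of_nonneg (hX.nonneg E)] at h1
    rw [← ofReal_norm, ← ENNReal.ofReal_mul (hX.nonneg E)]
    exact ENNReal.ofReal_le_ofReal h1
  · have h2 := (le_iSup₂ (f := fun (T : ℝ) (_ : 0 < T) =>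
      ENNReal.ofReal (1 / T) * ∫⁻ t in Set.Ioc 0 T, moment G H u σ ζ X t) T hT).trans (hC u)
    have h3 : ∀ t, ‖inner ℂ (delta x) (evolution H X t (delta u))‖ₑ ^ 2
        ≤ ENNReal.ofReal (Real.exp (-(σ * d))) * moment G H u σ ζ X t := by
      intro t
      have h4 := ENNReal.le_tsum (f := fun v : V =>
        ENNReal.ofReal (Real.exp (σ * (G.dist u v : ℝ) ^ ζ)) *
          ‖inner ℂ (delta v) (evolution H X t (delta u))‖ₑ ^ 2) x
      calc _ = ENNReal.ofReal (Real.exp (-(σ * d))) * (ENNReal.ofReal (Real.exp (σ * d)) *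
            ‖inner ℂ (delta x) (evolution H X t (delta u))‖ₑ ^ 2) := by
            rw [← mul_assoc, ← ENNReal.ofReal_mul (Real.exp_pos _).le, ← Real.exp_add]
            simp
        _ ≤ _ := by
          rw [hd, G.dist_comm]
          gcongr
          exact h4
    calc _ ≤ ENNReal.ofReal (1 / T) * ∫⁻ t in Set.Ioc 0 T,
          ENNReal.ofReal (Real.exp (-(σ * d))) * moment G H u σ ζ X t := by
          gcongr with t
          exact h3 t
      _ = ENNReal.ofReal (Real.exp (-(σ * d))) *
          (ENNReal.ofReal (1 / T) * ∫⁻ t in Set.Ioc 0 T, moment G H u σ ζ X t) := by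
        -- A finite constant can be pulled out without measurability of the moment in `t`.
        rw [lintegral_const_mul' _ _ ENNReal.ofReal_ne_top, mul_left_comm]
      _ ≤ ENNReal.ofReal (Real.exp (-(σ * d))) *
          ENNReal.ofReal (C * Real.exp (2 * ε * l)) := by gcongr
      _ ≤ _ := by
        rw [← ENNReal.ofReal_mul (Real.exp_pos _).le, mul_comm]
        refine ENNReal.ofReal_le_ofReal ?_
        gcongr
        exact le_abs_self C

/-- Squaring the SUDL bound doubles the rate: one `e^{-σd^ζ}` cancels the weight of the moment and
the other is summable, so `σ` is kept. -/
theorem SUDL.dl {β K : ℝ} (hβ0 : 0 ≤ β) (hβζ : β < ζ)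
    (hvol : ∀ L : ℕ, (⨆ u : V, sphereCard G u L) ≤ ENNReal.ofReal (K * Real.exp ((L : ℝ) ^ β)))
    (h : SUDL G o H I ζ) : DL G o H I ζ := by
  obtain ⟨σ, hσ, h⟩ := h
  obtain ⟨S, hS, hgS⟩ := exists_tsum_exp_neg_dist_le G hβ0 hβζ hvol hσ
  refine ⟨σ, hσ, fun ε hε X hX => ?_⟩
  obtain ⟨C, hC⟩ := h (ε / 2) (by positivity) X hX
  refine ⟨C ^ 2 * S, fun u => iSup_le fun t => ?_⟩
  set l : ℝ := (G.dist o u : ℝ) ^ ζ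
  have h1 : ∀ v, ENNReal.ofReal (Real.exp (σ * (G.dist u v : ℝ) ^ ζ)) *
      ‖inner ℂ (delta v) (evolution H X t (delta u))‖ₑ ^ 2
      ≤ ENNReal.ofReal (C ^ 2 * Real.exp (ε * l))
        * ENNReal.ofReal (Real.exp (-(σ * (G.dist u v : ℝ) ^ ζ))) := by
    intro v
    have h2 := (le_iSup (fun t : ℝ => hsNorm (chi v ∘L evolution H X t ∘L chi u)) t).trans (hC v u)
    rw [hsNorm_chi_comp_chi, G.dist_comm (u := v)] at h2
    set d : ℝ := (G.dist u v : ℝ) ^ ζ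
    calc _ ≤ ENNReal.ofReal (Real.exp (σ * d)) *
          ENNReal.ofReal (|C| * Real.exp (ε / 2 * l) * Real.exp (-(σ * d))) ^ 2 := by
          gcongr
          refine h2.trans (ENNReal.ofReal_le_ofReal ?_)
          gcongr
          exact le_abs_self C
      _ = _ := by
        rw [← ENNReal.ofReal_pow (by positivity), ← ENNReal.ofReal_mul (by positivity),
          ← ENNReal.ofReal_mul (by positivity), mul_pow, mul_pow, sq_abs, ← Real.exp_nat_mul,
          ← Real.exp_nat_mul]
        congr 1
        rw [mul_left_comm, ← Real.exp_add]
        congr 3 <;> push_cast <;> ring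
  calc moment G H u σ ζ X t ≤ ∑' v, ENNReal.ofReal (C ^ 2 * Real.exp (ε * l))
        * ENNReal.ofReal (Real.exp (-(σ * (G.dist u v : ℝ) ^ ζ))) := ENNReal.tsum_le_tsum h1
    _ ≤ ENNReal.ofReal (C ^ 2 * Real.exp (ε * l)) * ENNReal.ofReal S := by
      rw [ENNReal.tsum_mul_left]
      gcongr
      exact hgS u
    _ = _ := by
      rw [← ENNReal.ofReal_mul (by positivity)]
      congr 1
      ring

theorem lintegral_exp_neg_div {T : ℝ} (hT : 0 < T) :
    ∫⁻ t in Set.Ioi 0, ENNReal.ofReal (Real.exp (-t / T)) = ENNReal.ofReal T := by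
  have h := integral_exp_mul_Ioi (a := -T⁻¹) (by simpa using hT) 0
  have hi := integrableOn_exp_mul_Ioi (a := -T⁻¹) (by simpa using hT) 0
  have he : ∀ t : ℝ, Real.exp (-t / T) = Real.exp (-T⁻¹ * t) := fun t => by
    congr 1
    field_simp
  simp_rw [he]
  rw [← ofReal_integral_eq_lintegral_ofReal hi (Eventually.of_forall fun t => (Real.exp_pos _).le), h]
  simp

theorem DL.abelDL (h : DL G o H I ζ) : AbelDL G o H I ζ := by
  obtain ⟨σ, hσ, h⟩ := h
  refine ⟨σ, hσ, fun ε hε X hX => ?_⟩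
  obtain ⟨C, hC⟩ := h ε hε X hX
  refine ⟨C, fun u => iSup₂_le fun T hT => ?_⟩
  set B := ENNReal.ofReal (C * Real.exp (ε * (G.dist o u : ℝ) ^ ζ))
  calc _ ≤ ENNReal.ofReal (1 / T) *
        ∫⁻ t in Set.Ioi 0, ENNReal.ofReal (Real.exp (-t / T)) * B := by
        gcongr with t
        exact (le_iSup (fun t => moment G H u σ ζ X t) t).trans (hC u)
    _ = B := by
      rw [lintegral_mul_const' _ _ ENNReal.ofReal_ne_top, lintegral_exp_neg_div hT, ← mul_assoc,
        ← ENNReal.ofReal_mul (by positivity), one_div, inv_mul_cancel₀ hT.ne', ENNReal.ofReal_one,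
        one_mul]

theorem AbelDL.averagedDL (h : AbelDL G o H I ζ) : AveragedDL G o H I ζ := by
  obtain ⟨σ, hσ, h⟩ := h
  refine ⟨σ, hσ, fun ε hε X hX => ?_⟩
  obtain ⟨C, hC⟩ := h ε hε X hX
  refine ⟨Real.exp 1 * C, fun u => iSup₂_le fun T hT => ?_⟩
  have h1 := (le_iSup₂ (f := fun (T : ℝ) (_ : 0 < T) => ENNReal.ofReal (1 / T) *
    ∫⁻ t in Set.Ioi 0, ENNReal.ofReal (Real.exp (-t / T)) * moment G H u σ ζ X t) T hT).trans (hC u)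
  -- On `(0, T]` one has `1 ≤ e · e^{-t/T}`, so Abel means dominate Cesàro means up to the factor
  -- `e`.
  have h2 : ∫⁻ t in Set.Ioc 0 T, moment G H u σ ζ X t ≤ ENNReal.ofReal (Real.exp 1) *
      ∫⁻ t in Set.Ioi 0, ENNReal.ofReal (Real.exp (-t / T)) * moment G H u σ ζ X t := by
    rw [← lintegral_const_mul' _ _ ENNReal.ofReal_ne_top]
    refine (setLIntegral_mono' measurableSet_Ioc fun t ht => ?_).trans
      (lintegral_mono_set Set.Ioc_subset_Ioi_self)
    rw [← mul_assoc, ← ENNReal.ofReal_mul (Real.exp_pos _).le, ← Real.exp_add]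
    refine le_mul_of_one_le_left zero_le ?_
    rw [ENNReal.one_le_ofReal, Real.one_le_exp_iff, neg_div, ← sub_eq_add_neg, sub_nonneg,
      div_le_one hT]
    exact ht.2
  calc _ ≤ ENNReal.ofReal (1 / T) * (ENNReal.ofReal (Real.exp 1) *
        ∫⁻ t in Set.Ioi 0, ENNReal.ofReal (Real.exp (-t / T)) * moment G H u σ ζ X t) := by gcongr
    _ ≤ ENNReal.ofReal (Real.exp 1)
        * ENNReal.ofReal (C * Real.exp (ε * (G.dist o u : ℝ) ^ ζ)) := by
      rw [mul_left_comm]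
      gcongr
    _ = _ := by rw [← ENNReal.ofReal_mul (Real.exp_pos _).le, mul_assoc]

end TimeAverages
end DynLoc

open DynLoc
theorem theorem2p6 {V : Type*} (G : SimpleGraph V) (hG : G.Connected) (o : V)
    (β : ℝ) (hβ0 : 0 ≤ β) (hβ1 : β < 1)
    (K : ℝ)
    (hvol : ∀ L : ℕ, (⨆ u : V, sphereCard G u L) ≤ ENNReal.ofReal (K * Real.exp ((L : ℝ) ^ β)))
    (H : L2 V →ₗ.[ℂ] L2 V) (hH : IsSelfAdjoint H)
    (I : Set ℝ) (hI : I.OrdConnected) (hpp : HasPurePointSpectrumIn H I)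
    (ζ : ℝ) (hβζ : β < ζ) (hζ1 : ζ ≤ 1) :
    [AveragedDL G o H I ζ, AbelDL G o H I ζ, DL G o H I ζ, SUDL G o H I ζ, SULP G o H I ζ].TFAE := by
  tfae_have 1 → 5 := fun h => h.sulp hH hpp
  tfae_have 5 → 4 := fun h => h.sudl hβ0 hβζ hvol hH hpp
  tfae_have 4 → 3 := fun h => h.dl hβ0 hβζ hvol
  tfae_have 3 → 2 := fun h => h.abelDL
  tfae_have 2 → 1 := fun h => h.averagedDL
  tfae_finish
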